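/- Let $R$ be a discrete valuation ring with field of fractions $K$ and residue field $k$, let $E$ be an injective hull of the $R$-module $k$, and for an $R$-module $M$ put $M^\circ=\mathrm{Hom}_R(M,E)$ and $\mathrm{Rank}(M)=\dim_K(K\otimes_R M)$ (a cardinal number). Call $M$ reflexive if the canonical map $M\to M^{\circ\circ}$, $x\mapsto (f\mapsto f(x))$, is bijective, and bounded if $rM=0$ for some $0\neq r\in R$. Then for every $R$-module $M$: $$\mathrm{Rank}(M)=\mathrm{Rank}(M^{\circ\circ})\iff M=M_1\oplus M_2 \text{ for some submodules } M_1, M_2 \text{ of } M \text{ with } M_1 \text{ reflexive and } M_2 \text{ bounded.}$$ -/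

import Mathlib

open scoped TensorProduct

universe u v w

section Hull

variable {R : Type u} [CommRing R] {k : Type v} {E : Type w}
  [AddCommGroup k] [Module R k] [AddCommGroup E] [Module R E]

/-- The linear map `i : k → E` exhibits `E` as an injective hull of `k`: it is injective, `E` is an
injective module, and the extension is essential. -/
structure IsInjectiveHull (i : k →ₗ[R] E) : Prop where
  mono : Function.Injective i
  injective : Module.Injective R E
  essential : ∀ N : Submodule R E, N ⊓ LinearMap.range i = ⊥ → N = ⊥

end Hull

section Duality

variable (R : Type u) [CommRing R] (E : Type w) [AddCommGroup E] [Module R E]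
  (M : Type v) [AddCommGroup M] [Module R M]

/-- The dual `M° = Hom_R(M, E)`. It is the Matlis dual of `M` when `R` is a noetherian local ring
and `E` is an injective hull of the residue field of `R`. -/
abbrev MatlisDual : Type (max v w) := M →ₗ[R] E

/-- The canonical map `φ : M → M°°`, `x ↦ (f ↦ f x)`. -/
def matlisEval : M →ₗ[R] MatlisDual R E (MatlisDual R E M) :=
  LinearMap.applyₗ

/-- `M` is (Matlis-)reflexive: the canonical map `M → M°°` is bijective. -/
def IsMatlisReflexive : Prop :=
  Function.Bijective (matlisEval R E M)

end Duality

/-- The rank `dim_K (K ⊗_R M)` of a module over an integral domain `R` with field of fractions `K`,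
as a cardinal number. -/
noncomputable def moduleRank (R : Type u) [CommRing R] [IsDomain R]
    (M : Type v) [AddCommGroup M] [Module R M] : Cardinal.{max u v} :=
  Module.rank (FractionRing R) (FractionRing R ⊗[R] M)

/-- A module over an integral domain is bounded if it is annihilated by a nonzero ring element. -/
def IsBoundedModule (R : Type u) [CommRing R] (M : Type v) [AddCommGroup M] [Module R M] : Prop :=
  ∃ r : R, r ≠ 0 ∧ ∀ x : M, r • x = 0

/-- The residue field of a discrete valuation ring `R` has an injective hull, given by `K / R`. -/
theorem exists_isInjectiveHull_residueField_aux (R : Type u) [CommRing R] [IsDomain R]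
    [IsDiscreteValuationRing R] (K : Type u) [Field K] [Algebra R K] [IsFractionRing R K] :
    ∃ (E : Type u) (_ : AddCommGroup E) (_ : Module R E)
      (i : IsLocalRing.ResidueField R →ₗ[R] E), IsInjectiveHull i := by
  obtain ⟨p, hp⟩ := IsDiscreteValuationRing.exists_irreducible R
  have hp0 : p ≠ 0 := hp.ne_zero
  let B : Submodule R K := LinearMap.range (Algebra.linearMap R K)
  have hpK : algebraMap R K p ≠ 0 := by
    simpa using hp0
  have memB : ∀ x : K, x ∈ B ↔ ∃ r : R, algebraMap R K r = x := fun x => Iff.rfl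
  -- multiplication by `1/p` induces the embedding of the residue field
  let g : R →ₗ[R] (K ⧸ B) :=
    B.mkQ ∘ₗ LinearMap.toSpanSingleton R K ((algebraMap R K p)⁻¹)
  have hg : ∀ r : R, g r = 0 ↔ r ∈ IsLocalRing.maximalIdeal R := by
    intro r
    rw [hp.maximalIdeal_eq, Ideal.mem_span_singleton]
    change B.mkQ (r • (algebraMap R K p)⁻¹) = 0 ↔ _
    rw [Submodule.mkQ_apply, Submodule.Quotient.mk_eq_zero, memB]
    constructor
    · rintro ⟨s, hs⟩
      refine ⟨s, IsFractionRing.injective R K ?_⟩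
      rw [map_mul, hs, Algebra.smul_def]
      field_simp
    · rintro ⟨s, rfl⟩
      refine ⟨s, ?_⟩
      rw [Algebra.smul_def, map_mul]
      field_simp
  let i : IsLocalRing.ResidueField R →ₗ[R] (K ⧸ B) :=
    (IsLocalRing.maximalIdeal R).liftQ g (fun r hr => (hg r).2 hr)
  have hi : ∀ r : R, i (IsLocalRing.residue R r) = g r := fun r => rfl
  refine ⟨K ⧸ B, inferInstance, inferInstance, i, ?_, ?_, ?_⟩
  · rw [injective_iff_map_eq_zero]
    intro a ha
    obtain ⟨r, rfl⟩ := IsLocalRing.residue_surjective a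
    rw [hi, hg] at ha
    exact (IsLocalRing.residue_eq_zero_iff r).2 ha
  · apply Module.Baer.injective
    intro I f
    obtain ⟨a, rfl⟩ := (IsPrincipalIdealRing.principal I).principal
    by_cases ha : a = 0
    · subst ha
      refine ⟨0, fun x hx => ?_⟩
      have hx0 : x = 0 := by simpa using hx
      subst hx0
      have : (⟨0, hx⟩ : Submodule.span R {(0 : R)}) = 0 := rfl
      rw [this, map_zero, map_zero]
    · have haK : algebraMap R K a ≠ 0 := by simpa using ha
      obtain ⟨y, hy⟩ := B.mkQ_surjective (f ⟨a, Submodule.mem_span_singleton_self a⟩)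
      refine ⟨LinearMap.toSpanSingleton R (K ⧸ B) (B.mkQ ((algebraMap R K a)⁻¹ * y)), ?_⟩
      intro x hx
      obtain ⟨c, rfl⟩ := Submodule.mem_span_singleton.1 hx
      have e : (⟨c • a, hx⟩ : Submodule.span R {a})
          = c • ⟨a, Submodule.mem_span_singleton_self a⟩ := rfl
      rw [e, map_smul f, ← hy, LinearMap.toSpanSingleton_apply, ← map_smul, ← map_smul]
      congr 1
      rw [smul_eq_mul, Algebra.smul_def (c * a), map_mul, Algebra.smul_def c y]
      field_simp
  · intro N hN
    rw [eq_bot_iff]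
    intro z hz
    by_contra hz0
    replace hz0 : z ≠ 0 := fun h => hz0 (by simp [h])
    -- every nonzero element has a nonzero multiple in the image of `i`
    have key : ∀ (n : ℕ) (t : K ⧸ B), t ∈ N → t ≠ 0 → p ^ n • t = 0 → False := by
      intro n
      induction n with
      | zero => intro t _ h0 h; exact h0 (by simpa using h)
      | succ n ih =>
        intro t ht h0 h
        by_cases hpt : p • t = 0
        · obtain ⟨y, rfl⟩ := B.mkQ_surjective t
          rw [← map_smul, Submodule.mkQ_apply, Submodule.Quotient.mk_eq_zero, memB] at hpt
          obtain ⟨s, hs⟩ := hpt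
          have : B.mkQ y ∈ N ⊓ LinearMap.range i := by
            refine ⟨ht, IsLocalRing.residue R s, ?_⟩
            rw [hi]
            change B.mkQ (s • (algebraMap R K p)⁻¹) = B.mkQ y
            congr 1
            rw [Algebra.smul_def, hs, Algebra.smul_def]
            field_simp
          rw [hN] at this
          exact h0 (by simpa using this)
        · exact ih (p • t) (N.smul_mem p ht) hpt (by rw [smul_smul, ← pow_succ, h])
    obtain ⟨y, hy⟩ := B.mkQ_surjective z
    obtain ⟨a, b, hb, rfl⟩ := IsFractionRing.div_surjective (A := R) y
    have hb0 : b ≠ 0 := nonZeroDivisors.ne_zero hb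
    have hbK : algebraMap R K b ≠ 0 := by simpa using hb0
    obtain ⟨n, c, hc⟩ := IsDiscreteValuationRing.eq_unit_mul_pow_irreducible hb0 hp
    refine key n z hz hz0 ?_
    have h1 : p ^ n = (↑c⁻¹ : R) * b := by rw [hc, ← mul_assoc, Units.inv_mul, one_mul]
    rw [← hy, ← map_smul, Submodule.mkQ_apply, Submodule.Quotient.mk_eq_zero, memB]
    refine ⟨(↑c⁻¹ : R) * a, ?_⟩
    rw [Algebra.smul_def, h1, map_mul, map_mul]
    field_simp

/-- The residue field of a discrete valuation ring has an injective hull. -/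
theorem exists_isInjectiveHull_residueField (R : Type u) [CommRing R] [IsDomain R]
    [IsDiscreteValuationRing R] :
    ∃ (E : Type u) (_ : AddCommGroup E) (_ : Module R E)
      (i : IsLocalRing.ResidueField R →ₗ[R] E), IsInjectiveHull i :=
  exists_isInjectiveHull_residueField_aux R (FractionRing R)

/-!
Throughout, `R` is a discrete valuation ring with prime element `p`, `E` is an injective hull of its
residue field, and `M°` is the dual `Hom_R(M, E)`. Since `E` is an injective cogenerator, `M` embeds
in `M°°`.

If `M = M₁ ⊕ M₂` with `M₁` reflexive and `r` killing `M₂`, then `r` kills `M°° / M`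
(`exists_smul_eq_matlisEval_of_isCompl`), and the ranks agree because rank is additive.

Conversely, suppose the ranks agree. The rank of `M` is finite: a free submodule `R ^ (ι)` with
`ι` infinite makes `R ^ ι` contribute to the rank of `M°°` (`rank_pi_le_rank_bidual`), and the rank
of `R ^ ι` exceeds the cardinality of `ι` by the theorem of Erdős and Kaplansky over the residue
field (`lift_rank_lt_rank_pi`). By additivity, `M°° / M` is then torsion. This and
the finiteness of the rank are all that is used from here on.

The central tool is a gliding hump argument (`exists_forall_pow_smul_ne_zero`): if all maps from a
module `X` to `E` are torsion, then `p ^ j • X` is finitely generated for some `j`. For `X = Q°`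
with `Q°°` torsion it follows that `p ^ j • Q` is divisible, with finitely generated dual
(`exists_pow_smul_divisible`, `finite_dual_range_lsmul`).

Completeness of `R` enters in the form `End_R E = R` (`EndIsScalar`). It holds if `M` has an element
that is not torsion (`endIsScalar_of_not_torsion`). If `M` is torsion, then so is `M°°`, and
`p ^ j • M` is divisible for some `j`; either it vanishes, and `M` is bounded, or `E` is a direct
summand of `M`, and `End_R E` is finitely generated, hence equal to `R` by Nakayama's lemma
(`endIsScalar_of_divisible`).

Let finally `R` be complete. Then finitely generated modules, and modules with finitely generated
dual, are reflexive. Choose a finitely generated `F ≤ M` with `M / F` torsion; then `(M / F)°°` is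
torsion, so `p ^ j • (M / F)` is divisible for some `j`. Because series in `F` converge, this lifts
to `p ^ j • M ≤ D + F`, where `D` is the largest divisible submodule of `M`
(`EndIsScalar.pow_smul_mem_divisiblePart_sup`). So `p ^ j • (M / D)` is finitely generated, and free
for large `j`, which splits `M` as `D ⊕ L ⊕ B` with `L` finitely generated and `B` bounded; and
`D ⊕ L` is reflexive (`EndIsScalar.exists_isCompl`).
-/

namespace MatlisDuality

/-! ### The injective hull as a cogenerator -/

section Hull

variable {R : Type u} [CommRing R]

/-- An injective module receives an extension of `f` along any `h` whose kernel `f` kills: this is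
the form in which injectivity is used for extending maps from submodules, for factoring them
through quotients, and for dividing elements by ring elements. -/
theorem exists_comp_eq_of_ker_le {Q : Type*} [AddCommGroup Q] [Module R Q] (hQ : Module.Baer R Q)
    {A B : Type*} [AddCommGroup A] [Module R A] [AddCommGroup B] [Module R B]
    (h : A →ₗ[R] B) (f : A →ₗ[R] Q) (hk : ∀ a, h a = 0 → f a = 0) :
    ∃ g : B →ₗ[R] Q, ∀ a, g (h a) = f a := by
  obtain ⟨g, hg⟩ := hQ.extension_property ((LinearMap.ker h).liftQ h le_rfl)
    (by rw [← LinearMap.ker_eq_bot, Submodule.ker_liftQ_eq_bot _ _ _ le_rfl])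
    ((LinearMap.ker h).liftQ f (fun a ha => hk a ha))
  exact ⟨g, fun a => LinearMap.congr_fun hg ((LinearMap.ker h).mkQ a)⟩

variable [IsLocalRing R] {E : Type u} [AddCommGroup E] [Module R E]
  {i : IsLocalRing.ResidueField R →ₗ[R] E} {M : Type v} [AddCommGroup M] [Module R M]

theorem baer_of_isInjectiveHull (hE : IsInjectiveHull i) : Module.Baer R E :=
  Module.Baer.of_injective hE.injective

theorem smul_apply_one_eq_zero_iff (hE : IsInjectiveHull i) (r : R) :
    r • i 1 = 0 ↔ r ∈ IsLocalRing.maximalIdeal R := by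
  rw [← map_smul, map_eq_zero_iff i hE.mono, Algebra.smul_def, mul_one,
    IsLocalRing.ResidueField.algebraMap_eq, IsLocalRing.residue_eq_zero_iff]

/-- The injective hull of the residue field is a cogenerator, in relative form. -/
theorem exists_dual_ne_zero_of_notMem (hE : IsInjectiveHull i) (P : Submodule R M) {x : M}
    (hx : x ∉ P) : ∃ f : M →ₗ[R] E, (∀ y ∈ P, f y = 0) ∧ f x ≠ 0 := by
  have hx' : P.mkQ x ≠ 0 := by simpa using hx
  obtain ⟨g, hg⟩ := exists_comp_eq_of_ker_le (baer_of_isInjectiveHull hE)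
    (LinearMap.toSpanSingleton R (M ⧸ P) (P.mkQ x)) (LinearMap.toSpanSingleton R E (i 1)) (by
      intro r hr
      rw [LinearMap.toSpanSingleton_apply, smul_apply_one_eq_zero_iff hE]
      intro hu
      refine hx' ((IsUnit.smul_eq_zero hu).1 ?_)
      simpa using hr)
  refine ⟨g ∘ₗ P.mkQ, fun y hy => ?_, fun h0 => ?_⟩
  · rw [LinearMap.comp_apply, (Submodule.Quotient.mk_eq_zero P).2 hy |> fun h => (h : P.mkQ y = 0),
      map_zero]
  · have h1 := hg 1
    rw [LinearMap.toSpanSingleton_apply_one, LinearMap.toSpanSingleton_apply_one] at h1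
    rw [LinearMap.comp_apply, h1] at h0
    have := (smul_apply_one_eq_zero_iff hE 1).1 (by rw [one_smul, h0])
    exact (Ideal.ne_top_iff_one _).1 (IsLocalRing.maximalIdeal.isMaximal R).ne_top this

theorem exists_dual_ne_zero (hE : IsInjectiveHull i) {x : M} (hx : x ≠ 0) :
    ∃ f : M →ₗ[R] E, f x ≠ 0 := by
  obtain ⟨f, -, hf⟩ := exists_dual_ne_zero_of_notMem hE (⊥ : Submodule R M) (x := x) (by simpa)
  exact ⟨f, hf⟩

theorem matlisEval_injective (hE : IsInjectiveHull i) :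
    Function.Injective (matlisEval R E M) := by
  rw [injective_iff_map_eq_zero]
  intro x hx
  by_contra hx0
  obtain ⟨f, hf⟩ := exists_dual_ne_zero hE hx0
  exact hf (LinearMap.congr_fun hx f)

theorem isMatlisReflexive_iff_surjective (hE : IsInjectiveHull i) :
    IsMatlisReflexive R E M ↔ Function.Surjective (matlisEval R E M) :=
  ⟨fun h => h.2, fun h => ⟨matlisEval_injective hE, h⟩⟩

/-- Divisibility in `R` is detected by annihilators in `E`. -/
theorem dvd_of_forall_smul_eq_zero (hE : IsInjectiveHull i) {r s : R}
    (h : ∀ e : E, r • e = 0 → s • e = 0) : r ∣ s := by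
  rw [← Ideal.mem_span_singleton]
  by_contra hs
  obtain ⟨f, hf, hfs⟩ := exists_dual_ne_zero_of_notMem hE (Ideal.span {r}) hs
  refine hfs ?_
  have e1 : ∀ t : R, f t = t • f 1 := fun t => by rw [← map_smul, smul_eq_mul, mul_one]
  rw [e1]
  exact h _ (by rw [← e1]; exact hf r (Ideal.mem_span_singleton_self r))

end Hull

section DVR

variable {R : Type u} [CommRing R] [IsDomain R] [IsDiscreteValuationRing R]
  {E : Type u} [AddCommGroup E] [Module R E]
  {i : IsLocalRing.ResidueField R →ₗ[R] E} {M : Type v} [AddCommGroup M] [Module R M]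

theorem exists_smul_eq (hE : IsInjectiveHull i) {r : R} (hr : r ≠ 0) (e : E) :
    ∃ e' : E, r • e' = e := by
  obtain ⟨g, hg⟩ := exists_comp_eq_of_ker_le (baer_of_isInjectiveHull hE)
    (LinearMap.mulLeft R r) (LinearMap.toSpanSingleton R E e) (by
      intro a ha
      have : a = 0 := by simpa [hr] using ha
      simp [this])
  refine ⟨g 1, ?_⟩
  have := hg 1
  rw [LinearMap.toSpanSingleton_apply_one] at this
  rw [← this, ← map_smul]
  simp

theorem exists_pow_smul_eq_zero {p : R} (hp : Irreducible p) {r : R} (hr : r ≠ 0) {x : M}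
    (h : r • x = 0) : ∃ n, p ^ n • x = 0 := by
  obtain ⟨n, c, rfl⟩ := IsDiscreteValuationRing.eq_unit_mul_pow_irreducible hr hp
  refine ⟨n, ?_⟩
  rw [mul_smul] at h
  exact (IsUnit.smul_eq_zero c.isUnit).1 h

/-- An element of `E` generating a torsion-free submodule would meet the residue field trivially,
against essentiality. -/
theorem hull_exists_pow_smul_eq_zero (hE : IsInjectiveHull i) {p : R} (hp : Irreducible p)
    (e : E) : ∃ n, p ^ n • e = 0 := by
  by_contra! hn
  have hfree : ∀ r : R, r • e = 0 → r = 0 := by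
    intro r h
    by_contra hr
    obtain ⟨n, h0⟩ := exists_pow_smul_eq_zero hp hr h
    exact hn n h0
  have hbot : Submodule.span R {e} = ⊥ := by
    refine hE.essential _ (eq_bot_iff.2 ?_)
    rintro x ⟨hx, c, rfl⟩
    obtain ⟨r, hr⟩ := Submodule.mem_span_singleton.1 hx
    obtain ⟨s, rfl⟩ := IsLocalRing.residue_surjective c
    have hc : p • IsLocalRing.residue R s = 0 := by
      rw [Algebra.smul_def, IsLocalRing.ResidueField.algebraMap_eq,
        (IsLocalRing.residue_eq_zero_iff p).2 (by
          rw [hp.maximalIdeal_eq]; exact Ideal.mem_span_singleton_self p), zero_mul]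
    have : p * r = 0 := hfree _ (by rw [mul_smul, hr, ← map_smul, hc, map_zero])
    have hr0 : r = 0 := by simpa [hp.ne_zero] using this
    rw [← hr, hr0, zero_smul]
    exact Submodule.zero_mem _
  exact hn 0 (by rw [Submodule.span_singleton_eq_bot.1 hbot, smul_zero])

/-- The `p`-torsion of `E` is the residue field. -/
theorem hull_socle (hE : IsInjectiveHull i) {p : R} (hp : Irreducible p) {e : E}
    (he : p • e = 0) : ∃ s : R, e = s • i 1 := by
  by_cases h0 : e = 0
  · exact ⟨0, by rw [h0, zero_smul]⟩
  have hne : Submodule.span R {e} ⊓ LinearMap.range i ≠ ⊥ := fun h =>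
    h0 (Submodule.span_singleton_eq_bot.1 (hE.essential _ h))
  obtain ⟨x, ⟨hx, c, rfl⟩, hx0⟩ := Submodule.exists_mem_ne_zero_of_ne_bot hne
  obtain ⟨r, hr⟩ := Submodule.mem_span_singleton.1 hx
  obtain ⟨s, rfl⟩ := IsLocalRing.residue_surjective c
  have hu : IsUnit r := by
    by_contra hu
    have : r ∈ IsLocalRing.maximalIdeal R := hu
    rw [hp.maximalIdeal_eq, Ideal.mem_span_singleton] at this
    obtain ⟨t, rfl⟩ := this
    exact hx0 (by rw [← hr, mul_comm, mul_smul, he, smul_zero])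
  obtain ⟨c, rfl⟩ := hu
  refine ⟨(↑c⁻¹ : R) * s, ?_⟩
  have hs : i (IsLocalRing.residue R s) = s • i 1 := by
    rw [← map_smul, Algebra.smul_def, mul_one]; rfl
  rw [mul_smul, ← hs, ← hr, smul_smul, Units.inv_mul, one_smul]

end DVR

/-! ### Maps into the injective hull that are not torsion -/

section GlidingHump

variable {R : Type u} [CommRing R] [IsLocalRing R] {E : Type u} [AddCommGroup E] [Module R E]
  {i : IsLocalRing.ResidueField R →ₗ[R] E} {X : Type v} [AddCommGroup X] [Module R X]

/-- A gliding hump: if no `p ^ j • X` lies in a finitely generated submodule, then some `X → E` is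
not killed by any power of `p`. The map is built on the union of an ascending chain of finitely
generated submodules `N j`; passing to `N (j + 1)`, the map is corrected, if need be, by one that
vanishes on `N j`, so that `p ^ j` does not kill it on `N (j + 1)`. -/
theorem exists_forall_pow_smul_ne_zero (hE : IsInjectiveHull i) (p : R)
    (h : ∀ (j : ℕ) (N : Submodule R X), N.FG → ∃ y, p ^ j • y ∉ N) :
    ∃ f : X →ₗ[R] E, ∀ j : ℕ, p ^ j • f ≠ 0 := by
  have step : ∀ (j : ℕ) (s : {N : Submodule R X // N.FG} × (X →ₗ[R] E)),
      ∃ s' : {N : Submodule R X // N.FG} × (X →ₗ[R] E), s.1.1 ≤ s'.1.1 ∧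
        (∀ x ∈ s.1.1, s'.2 x = s.2 x) ∧ ∃ y ∈ s'.1.1, p ^ j • s'.2 y ≠ 0 := by
    rintro j ⟨⟨N, hN⟩, F⟩
    obtain ⟨y, hy⟩ := h j N hN
    obtain ⟨g, hg, hgy⟩ := exists_dual_ne_zero_of_notMem hE N hy
    have hN' : (N ⊔ Submodule.span R {y}).FG := hN.sup (Submodule.fg_span_singleton y)
    have hyN : y ∈ N ⊔ Submodule.span R {y} :=
      Submodule.mem_sup_right (Submodule.mem_span_singleton_self y)
    rw [map_smul] at hgy
    by_cases hF : p ^ j • F y = 0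
    · refine ⟨⟨⟨_, hN'⟩, F + g⟩, le_sup_left, fun x hx => ?_, y, hyN, ?_⟩
      · simp [hg x hx]
      · simpa [hF] using hgy
    · exact ⟨⟨⟨_, hN'⟩, F⟩, le_sup_left, fun x _ => rfl, y, hyN, hF⟩
  choose nxt hle hagree hump using step
  let s : ℕ → {N : Submodule R X // N.FG} × (X →ₗ[R] E) :=
    fun n => Nat.rec (⟨⊥, Submodule.fg_bot⟩, 0) nxt n
  have hmono : Monotone fun n => (s n).1.1 := monotone_nat_of_le_succ fun n => hle n (s n)
  have hcompat : ∀ m n, m ≤ n → ∀ x ∈ (s m).1.1, (s n).2 x = (s m).2 x := by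
    intro m n hmn
    induction n, hmn using Nat.le_induction with
    | base => exact fun x _ => rfl
    | succ n hmn ih => exact fun x hx => (hagree n (s n) x (hmono hmn hx)).trans (ih x hx)
  have hmem : ∀ x, x ∈ (⨆ n, (s n).1.1) ↔ ∃ n, x ∈ (s n).1.1 := fun x =>
    Submodule.mem_iSup_of_directed _ hmono.directed_le
  choose idx hidx using fun x : ↥(⨆ n, (s n).1.1) => (hmem x).1 x.2
  have hval : ∀ (x : ↥(⨆ n, (s n).1.1)) (n : ℕ), (x : X) ∈ (s n).1.1 →
      (s (idx x)).2 x = (s n).2 x := by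
    intro x n hx
    rcases le_total (idx x) n with hn | hn
    · exact (hcompat _ _ hn x (hidx x)).symm
    · exact hcompat _ _ hn x hx
  let f₀ : ↥(⨆ n, (s n).1.1) →ₗ[R] E :=
    { toFun := fun x => (s (idx x)).2 x
      map_add' := fun x y => by
        have hx := hmono (le_max_left (idx x) (idx y)) (hidx x)
        have hy := hmono (le_max_right (idx x) (idx y)) (hidx y)
        rw [hval x _ hx, hval y _ hy, hval (x + y) _ (Submodule.add_mem _ hx hy)]
        exact map_add _ _ _
      map_smul' := fun r x => by
        rw [hval (r • x) _ (Submodule.smul_mem _ r (hidx x))]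
        exact map_smul _ _ _ }
  obtain ⟨f, hf⟩ := exists_comp_eq_of_ker_le (baer_of_isInjectiveHull hE)
    (Submodule.subtype _) f₀ (fun a ha => by
      have : a = 0 := by simpa using ha
      rw [this, map_zero])
  refine ⟨f, fun j hj => ?_⟩
  obtain ⟨y, hy, hne⟩ := hump j (s j)
  refine hne ?_
  have hy' : y ∈ (s (j + 1)).1.1 := hy
  have hyU : y ∈ ⨆ n, (s n).1.1 := (hmem y).2 ⟨j + 1, hy'⟩
  have hfy : f y = (s (idx ⟨y, hyU⟩)).2 y := hf ⟨y, hyU⟩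
  have h1 : f y = (s (j + 1)).2 y := hfy.trans (hval ⟨y, hyU⟩ (j + 1) hy')
  change p ^ j • (s (j + 1)).2 y = 0
  rw [← h1]
  exact LinearMap.congr_fun hj y

end GlidingHump

/-! ### Permanence of reflexivity -/

section Reflexive

variable {R : Type u} [CommRing R] {E : Type u} [AddCommGroup E] [Module R E]

theorem surjective_matlisEval_prod
    {A B : Type*} [AddCommGroup A] [Module R A] [AddCommGroup B] [Module R B]
    (hA : Function.Surjective (matlisEval R E A)) (hB : Function.Surjective (matlisEval R E B)) :
    Function.Surjective (matlisEval R E (A × B)) := by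
  intro φ
  obtain ⟨a, ha⟩ := hA (φ ∘ₗ LinearMap.lcomp R E (LinearMap.fst R A B))
  obtain ⟨b, hb⟩ := hB (φ ∘ₗ LinearMap.lcomp R E (LinearMap.snd R A B))
  refine ⟨(a, b), LinearMap.ext fun f => ?_⟩
  have h1 : f (a, 0) = φ ((f ∘ₗ LinearMap.inl R A B) ∘ₗ LinearMap.fst R A B) :=
    LinearMap.congr_fun ha (f ∘ₗ LinearMap.inl R A B)
  have h2 : f (0, b) = φ ((f ∘ₗ LinearMap.inr R A B) ∘ₗ LinearMap.snd R A B) :=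
    LinearMap.congr_fun hb (f ∘ₗ LinearMap.inr R A B)
  calc f (a, b) = f (a, 0) + f (0, b) := by rw [← map_add]; simp
    _ = φ f := by
      rw [h1, h2, ← map_add]
      congr 1
      ext <;> simp <;> exact f.map_zero

variable [IsLocalRing R] {i : IsLocalRing.ResidueField R →ₗ[R] E}

theorem surjective_matlisEval_of_surjective (hE : IsInjectiveHull i)
    {A B : Type*} [AddCommGroup A] [Module R A] [AddCommGroup B] [Module R B]
    (q : A →ₗ[R] B) (hq : Function.Surjective q)
    (hA : Function.Surjective (matlisEval R E A)) : Function.Surjective (matlisEval R E B) := by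
  intro φ
  -- `B°` embeds in `A°`, so `φ` extends to `A°`
  obtain ⟨ψ, hψ⟩ := exists_comp_eq_of_ker_le (baer_of_isInjectiveHull hE)
    (LinearMap.lcomp R E q) φ (by
      intro f hf
      have : f = 0 := by
        ext b
        obtain ⟨a, rfl⟩ := hq b
        exact LinearMap.congr_fun hf a
      rw [this, map_zero])
  obtain ⟨a, rfl⟩ := hA ψ
  exact ⟨q a, LinearMap.ext fun f => hψ f⟩

theorem surjective_matlisEval_of_extension (hE : IsInjectiveHull i)
    {A B : Type*} [AddCommGroup A] [Module R A] [AddCommGroup B] [Module R B]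
    (q : A →ₗ[R] B) (hq : Function.Surjective q)
    (hker : Function.Surjective (matlisEval R E (LinearMap.ker q)))
    (hB : Function.Surjective (matlisEval R E B)) : Function.Surjective (matlisEval R E A) := by
  intro φ
  obtain ⟨b, hb⟩ := hB (φ ∘ₗ LinearMap.lcomp R E q)
  obtain ⟨a, rfl⟩ := hq b
  -- `φ - ev a` vanishes on the functionals that kill `ker q`, so it comes from `(ker q)°°`
  obtain ⟨θ, hθ⟩ := exists_comp_eq_of_ker_le (baer_of_isInjectiveHull hE)
    (LinearMap.lcomp R E (LinearMap.ker q).subtype) (φ - matlisEval R E A a) (by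
      intro f hf
      obtain ⟨g, hg⟩ := exists_comp_eq_of_ker_le (baer_of_isInjectiveHull hE) q f
        (fun x hx => LinearMap.congr_fun hf ⟨x, hx⟩)
      have hgf : g ∘ₗ q = f := LinearMap.ext hg
      have h1 : g (q a) = φ (g ∘ₗ q) := LinearMap.congr_fun hb g
      rw [hgf, hg] at h1
      rw [LinearMap.sub_apply, sub_eq_zero]
      exact h1.symm)
  obtain ⟨x, rfl⟩ := hker θ
  refine ⟨a + x, LinearMap.ext fun f => ?_⟩
  have h2 : f x = φ f - f a := hθ f
  change f (a + x) = φ f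
  rw [map_add, h2, add_sub_cancel]

/-- A module with reflexive dual is reflexive: a functional on `A°°` that vanishes on the image of
`A` is the evaluation at some `f : A → E`, and `f = 0`. -/
theorem surjective_matlisEval_of_dual (hE : IsInjectiveHull i) {A : Type*} [AddCommGroup A]
    [Module R A] (hA : Function.Surjective (matlisEval R E (MatlisDual R E A))) :
    Function.Surjective (matlisEval R E A) := by
  intro φ
  by_contra hφ
  obtain ⟨ψ, hψ, hne⟩ := exists_dual_ne_zero_of_notMem hE (LinearMap.range (matlisEval R E A))
    (x := φ) (by simpa using hφ)
  obtain ⟨f, rfl⟩ := hA ψ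
  have : f = 0 := LinearMap.ext fun a => hψ _ ⟨a, rfl⟩
  exact hne (by rw [this, map_zero, LinearMap.zero_apply])

end Reflexive

/-! ### Complete discrete valuation rings -/

section EndIsScalar

variable (R : Type u) [CommRing R] (E : Type w) [AddCommGroup E] [Module R E]

/-- Every endomorphism of `E` is multiplication by an element of `R`. For `E` an injective hull of
the residue field of a discrete valuation ring `R`, the ring `End_R E` is the completion of `R`, and
the condition says that `R` is complete. -/
def EndIsScalar : Prop := ∀ φ : E →ₗ[R] E, ∃ t : R, ∀ e, φ e = t • e

variable {R E}

theorem EndIsScalar.surjective_matlisEval_self (hc : EndIsScalar R E) :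
    Function.Surjective (matlisEval R E R) := by
  intro φ
  obtain ⟨t, ht⟩ := hc (φ ∘ₗ (LinearMap.ringLmapEquivSelf R R E).symm.toLinearMap)
  refine ⟨t, LinearMap.ext fun f => ?_⟩
  have h1 := ht (f 1)
  have h2 : (LinearMap.ringLmapEquivSelf R R E).symm (f 1) = f :=
    (LinearMap.ringLmapEquivSelf R R E).symm_apply_apply f
  rw [LinearMap.comp_apply, LinearEquiv.coe_coe, h2] at h1
  rw [h1, ← map_smul, smul_eq_mul, mul_one]
  rfl

end EndIsScalar

section Complete

variable {R : Type u} [CommRing R] [IsLocalRing R] {E : Type u} [AddCommGroup E] [Module R E]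
  {i : IsLocalRing.ResidueField R →ₗ[R] E} {M : Type v} [AddCommGroup M] [Module R M]

theorem EndIsScalar.surjective_matlisEval_of_fg (hc : EndIsScalar R E) (hE : IsInjectiveHull i)
    {N : Submodule R M} (hN : N.FG) : Function.Surjective (matlisEval R E N) := by
  induction N, hN using Submodule.fg_induction with
  | singleton x =>
    refine surjective_matlisEval_of_surjective hE (LinearMap.toSpanSingleton R
      (Submodule.span R {x}) ⟨x, Submodule.mem_span_singleton_self x⟩) ?_
      hc.surjective_matlisEval_self
    rintro ⟨y, hy⟩
    obtain ⟨r, rfl⟩ := Submodule.mem_span_singleton.1 hy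
    exact ⟨r, rfl⟩
  | sup N₁ N₂ _ _ h₁ h₂ =>
    refine surjective_matlisEval_of_surjective hE
      ((Submodule.inclusion le_sup_left).coprod (Submodule.inclusion le_sup_right)) ?_
      (surjective_matlisEval_prod h₁ h₂)
    rintro ⟨y, hy⟩
    obtain ⟨a, ha, b, hb, rfl⟩ := Submodule.mem_sup.1 hy
    exact ⟨(⟨a, ha⟩, ⟨b, hb⟩), Subtype.ext (by simp)⟩

theorem EndIsScalar.surjective_matlisEval_of_finite_dual (hc : EndIsScalar R E)
    (hE : IsInjectiveHull i) (h : Module.Finite R (MatlisDual R E M)) :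
    Function.Surjective (matlisEval R E M) := by
  refine surjective_matlisEval_of_dual hE ?_
  exact surjective_matlisEval_of_surjective hE
    (Submodule.topEquiv (R := R) (M := MatlisDual R E M)).toLinearMap
    (Submodule.topEquiv (R := R) (M := MatlisDual R E M)).surjective
    (hc.surjective_matlisEval_of_fg hE h.1)

end Complete

section CompleteDVR

variable {R : Type u} [CommRing R] [IsDomain R] [IsDiscreteValuationRing R]
  {E : Type u} [AddCommGroup E] [Module R E]
  {i : IsLocalRing.ResidueField R →ₗ[R] E} {M : Type v} [AddCommGroup M] [Module R M]

/-- The recursion `b n = a n + p * b (n + 1)`, formally `b n = ∑ k, p ^ k * a (n + k)`, is solvable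
in `R`: the series makes sense as an endomorphism of `E`, since on each element of `E` the sum is
finite. -/
theorem EndIsScalar.exists_series (hc : EndIsScalar R E) (hE : IsInjectiveHull i) {p : R}
    (hp : Irreducible p) (a : ℕ → R) : ∃ b : ℕ → R, ∀ n, b n = a n + p * b (n + 1) := by
  have hstab : ∀ (n m l : ℕ) (e : E), p ^ m • e = 0 → m ≤ l →
      ∑ k ∈ Finset.range l, (p ^ k * a (n + k)) • e
        = ∑ k ∈ Finset.range m, (p ^ k * a (n + k)) • e := by
    intro n m l e he hml
    refine (Finset.sum_subset (Finset.range_mono hml) fun k _ hk => ?_).symm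
    obtain ⟨d, rfl⟩ := Nat.exists_eq_add_of_le (not_lt.1 (Finset.mem_range.not.1 hk))
    rw [pow_add, mul_assoc, mul_comm, mul_smul, he, smul_zero]
  have hpow : ∀ (m l : ℕ) (e : E), p ^ m • e = 0 → m ≤ l → p ^ l • e = 0 := by
    intro m l e he hml
    obtain ⟨d, rfl⟩ := Nat.exists_eq_add_of_le hml
    rw [pow_add, mul_comm, mul_smul, he, smul_zero]
  choose o ho using hull_exists_pow_smul_eq_zero hE hp
  have hval : ∀ (n m : ℕ) (e : E), p ^ m • e = 0 →
      ∑ k ∈ Finset.range (o e), (p ^ k * a (n + k)) • e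
        = ∑ k ∈ Finset.range m, (p ^ k * a (n + k)) • e := by
    intro n m e he
    rw [← hstab n (o e) (max (o e) m) e (ho e) (le_max_left _ _),
      hstab n m (max (o e) m) e he (le_max_right _ _)]
  let φ : ℕ → E →ₗ[R] E := fun n =>
    { toFun := fun e => ∑ k ∈ Finset.range (o e), (p ^ k * a (n + k)) • e
      map_add' := fun x y => by
        have hx := hpow _ (max (o x) (o y)) x (ho x) (le_max_left _ _)
        have hy := hpow _ (max (o x) (o y)) y (ho y) (le_max_right _ _)
        rw [hval n _ x hx, hval n _ y hy, hval n _ (x + y) (by rw [smul_add, hx, hy, add_zero]),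
          ← Finset.sum_add_distrib]
        exact Finset.sum_congr rfl fun k _ => smul_add _ _ _
      map_smul' := fun r x => by
        rw [hval n _ (r • x) (by rw [smul_comm, ho x, smul_zero]), RingHom.id_apply,
          Finset.smul_sum]
        exact Finset.sum_congr rfl fun k _ => smul_comm _ _ _ }
  choose b hb using fun n => hc (φ n)
  refine ⟨b, fun n => ?_⟩
  rw [← sub_eq_zero, ← zero_dvd_iff]
  refine dvd_of_forall_smul_eq_zero hE fun e _ => ?_
  have h1 : ∑ k ∈ Finset.range (o e), (p ^ k * a (n + 1 + k)) • e = b (n + 1) • e := hb (n + 1) e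
  have h2 : ∑ k ∈ Finset.range (o e), (p ^ k * a (n + k)) • e = b n • e := hb n e
  rw [hval n (o e + 1) e (hpow _ _ e (ho e) (Nat.le_succ _)), Finset.sum_range_succ'] at h2
  rw [sub_smul, add_smul, ← h2, mul_smul p, ← h1, Finset.smul_sum, sub_eq_zero, add_comm]
  congr 1
  · simp
  · refine Finset.sum_congr rfl fun k _ => ?_
    rw [smul_smul, pow_succ', mul_assoc, add_assoc, add_comm 1 k]

theorem EndIsScalar.exists_series_of_fg (hc : EndIsScalar R E) (hE : IsInjectiveHull i) {p : R}
    (hp : Irreducible p) {N : Submodule R M} (hN : N.FG) (a : ℕ → M) (ha : ∀ n, a n ∈ N) :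
    ∃ b : ℕ → M, (∀ n, b n ∈ N) ∧ ∀ n, b n = a n + p • b (n + 1) := by
  induction N, hN using Submodule.fg_induction generalizing a with
  | singleton x =>
    choose r hr using fun n => Submodule.mem_span_singleton.1 (ha n)
    obtain ⟨b, hb⟩ := hc.exists_series hE hp r
    refine ⟨fun n => b n • x, fun n => Submodule.smul_mem _ _ (Submodule.mem_span_singleton_self x),
      fun n => ?_⟩
    rw [← hr n, smul_smul, ← add_smul, ← hb n]
  | sup N₁ N₂ _ _ h₁ h₂ =>
    choose y hy z hz hyz using fun n => Submodule.mem_sup.1 (ha n)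
    obtain ⟨b, hbN, hb⟩ := h₁ y hy
    obtain ⟨c, hcN, hc⟩ := h₂ z hz
    refine ⟨b + c, fun n => Submodule.add_mem_sup (hbN n) (hcN n), fun n => ?_⟩
    rw [Pi.add_apply, Pi.add_apply, ← hyz n, smul_add, add_add_add_comm, ← hb n, ← hc n]

end CompleteDVR

/-! ### Rank -/

section Rank

variable {R : Type u} [CommRing R] {M : Type v} [AddCommGroup M] [Module R M]

theorem rank_quotient_eq_zero_iff (P : Submodule R M) :
    Module.rank R (M ⧸ P) = 0 ↔ ∀ x : M, ∃ r : R, r ≠ 0 ∧ r • x ∈ P := by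
  rw [rank_eq_zero_iff, P.mkQ_surjective.forall]
  simp only [Submodule.mkQ_apply, ← Submodule.Quotient.mk_smul, Submodule.Quotient.mk_eq_zero]

variable [IsDomain R]

theorem moduleRank_eq_lift_rank : moduleRank R M = Cardinal.lift.{u} (Module.rank R M) := by
  have h := IsLocalizedModule.lift_rank_eq (nonZeroDivisors R)
    (TensorProduct.mk R (FractionRing R) M 1) le_rfl
  rw [moduleRank, IsFractionRing.rank_right_eq R (FractionRing R)]
  rw [Cardinal.lift_id'.{v, max u v}, Cardinal.lift_umax.{v, u}] at h
  exact h

theorem rank_quotient_range_add_lift_rank {N : Type max u v} [AddCommGroup N] [Module R N]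
    {f : M →ₗ[R] N} (hf : Function.Injective f) :
    Module.rank R (N ⧸ LinearMap.range f) + Cardinal.lift.{u} (Module.rank R M) =
      Module.rank R N := by
  have h := (LinearEquiv.ofInjective f hf).lift_rank_eq
  rw [Cardinal.lift_id'.{v, max u v}, Cardinal.lift_umax.{v, u}] at h
  rw [h]
  exact rank_quotient_add_rank_of_isDomain _

theorem exists_fg_isTorsion_quotient (h : Module.rank R M < Cardinal.aleph0) :
    ∃ F : Submodule R M, F.FG ∧ ∀ x : M, ∃ r : R, r ≠ 0 ∧ r • x ∈ F := by
  obtain ⟨s, hs, hli⟩ := exists_set_linearIndependent_of_isDomain R M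
  have hfin : s.Finite := by rwa [← Cardinal.lt_aleph0_iff_set_finite, hs]
  refine ⟨Submodule.span R s, Submodule.fg_span hfin, ?_⟩
  rw [← rank_quotient_eq_zero_iff]
  have h1 := rank_quotient_add_rank_of_isDomain (Submodule.span R s)
  rw [rank_span_set hli, hs] at h1
  exact Cardinal.eq_of_add_eq_add_right (b := Module.rank R M) (by rw [h1, zero_add]) h

end Rank

/-! ### The bidual of a module of infinite rank -/

section InfiniteRank

variable {R : Type u} [CommRing R] [IsDomain R] [IsDiscreteValuationRing R]
  {E : Type u} [AddCommGroup E] [Module R E]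
  {i : IsLocalRing.ResidueField R →ₗ[R] E} {M : Type v} [AddCommGroup M] [Module R M]

open IsLocalRing

/-- Vectors over `R` whose reductions are linearly independent over the residue field are linearly
independent: by induction, the coefficients of a relation are divisible by all powers of `p`. -/
theorem linearIndependent_of_residue {ι τ : Type*} (a : τ → ι → R)
    (h : LinearIndependent (ResidueField R) fun t j => residue R (a t j)) :
    LinearIndependent R a := by
  obtain ⟨p, hp⟩ := IsDiscreteValuationRing.exists_irreducible R
  rw [linearIndependent_iff'] at h ⊢
  intro s g hg
  have hdiv : ∀ n : ℕ, ∀ t ∈ s, p ^ n ∣ g t := by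
    intro n
    induction n with
    | zero => simp
    | succ n ih =>
      choose! c hc using ih
      have h0 : ∑ t ∈ s, c t • a t = 0 := by
        have : p ^ n • ∑ t ∈ s, c t • a t = 0 := by
          rw [Finset.smul_sum, ← hg]
          exact Finset.sum_congr rfl fun t ht => by rw [smul_smul, ← hc t ht]
        exact (smul_eq_zero.1 this).resolve_left (pow_ne_zero n hp.ne_zero)
      intro t ht
      have h1 := h s (fun t => residue R (c t)) (by
        ext j
        have := congrArg (residue R) (congrFun h0 j)
        simpa [Finset.sum_apply] using this) t ht
      rw [residue_eq_zero_iff, hp.maximalIdeal_eq, Ideal.mem_span_singleton] at h1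
      rw [hc t ht, pow_succ]
      exact mul_dvd_mul_left _ h1
  intro t ht
  by_contra h0
  obtain ⟨n, c, hc⟩ := IsDiscreteValuationRing.eq_unit_mul_pow_irreducible h0 hp
  have h1 := hdiv (n + 1) t ht
  rw [hc, Units.dvd_mul_left, pow_dvd_pow_iff hp.ne_zero hp.not_isUnit] at h1
  omega

theorem lift_rank_lt_rank_pi {ι : Type v} [Infinite ι] :
    Cardinal.lift.{u} (Cardinal.mk ι) < Module.rank R (ι → R) := by
  obtain ⟨⟨τ, b⟩⟩ := Module.Free.exists_basis (R := ResidueField R) (M := ι → ResidueField R)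
  choose σ hσ using residue_surjective (R := R)
  have hli : LinearIndependent R fun t j => σ (b t j) :=
    linearIndependent_of_residue _ (by simpa only [hσ] using b.linearIndependent)
  refine lt_of_lt_of_le ?_ hli.cardinal_le_rank
  rw [b.mk_eq_rank'', rank_fun_infinite, Cardinal.mk_arrow]
  refine Cardinal.cantor' _ ?_
  rw [Cardinal.one_lt_lift_iff, Cardinal.one_lt_iff_nontrivial]
  infer_instance

/-- For a linearly independent family `x : ι → M`, the bidual of `M` has at least the rank of
`R ^ ι`: a vector `a` of scalars gives a functional on the dual of the free module on `x`, namely an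
extension of `f ↦ ∑ j, a j • f (x j)` from those `f` for which almost all `f (x j)` vanish. -/
theorem rank_pi_le_rank_bidual (hE : IsInjectiveHull i) {ι : Type v} {x : ι → M}
    (hx : LinearIndependent R x) :
    Module.rank R (ι → R) ≤ Module.rank R (MatlisDual R E (MatlisDual R E M)) := by
  classical
  have hB := baer_of_isInjectiveHull hE
  -- every family in `E` is the restriction of some `f : M → E`
  have hext : ∀ e : ι → E, ∃ f : M →ₗ[R] E, ∀ j, f (x j) = e j := by
    intro e
    obtain ⟨f, hf⟩ := exists_comp_eq_of_ker_le hB (Finsupp.linearCombination R x)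
      (Finsupp.linearCombination R e) (fun c hc => by
        rw [(linearIndependent_iff.1 hx) c hc, map_zero])
    exact ⟨f, fun j => by simpa using hf (Finsupp.single j 1)⟩
  have hΦ : ∀ a : ι → R, ∃ Φ : MatlisDual R E (MatlisDual R E M),
      ∀ (f : M →ₗ[R] E) (c : ι →₀ E), (∀ j, f (x j) = c j) → Φ f = c.sum fun j e => a j • e := by
    intro a
    obtain ⟨Ψ, hΨ⟩ := exists_comp_eq_of_ker_le hB
      (Finsupp.lcoeFun : (ι →₀ E) →ₗ[R] (ι → E))
      (Finsupp.lsum R fun j => a j • (LinearMap.id : E →ₗ[R] E)) (fun c hc => by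
        have h0 : c = 0 := DFunLike.coe_injective hc
        rw [h0, map_zero])
    refine ⟨Ψ ∘ₗ LinearMap.pi fun j => LinearMap.applyₗ (x j), fun f c hc => ?_⟩
    have h1 : (fun j => f (x j)) = ⇑c := funext hc
    exact (congrArg Ψ h1).trans (hΨ c)
  choose Φ hΦ using hΦ
  have hsingle : ∀ (j : ι) (e : E) (f : M →ₗ[R] E), (∀ l, f (x l) = Finsupp.single j e l) →
      ∀ a, Φ a f = a j • e := fun j e f hf a => by
    rw [hΦ a f _ hf, Finsupp.sum_single_index (h := fun j e => a j • e) (smul_zero _)]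
  rw [Module.rank_def]
  refine ciSup_le' fun s => ?_
  have hs := s.2
  have hli : LinearIndependent R fun t : s.1 => Φ t.1 := by
    rw [LinearIndepOn, linearIndependent_iff'] at hs
    rw [linearIndependent_iff']
    intro t g hg
    refine hs t g (funext fun j => ?_)
    rw [Pi.zero_apply, ← zero_dvd_iff]
    refine dvd_of_forall_smul_eq_zero hE fun e _ => ?_
    obtain ⟨f, hf⟩ := hext fun l => Finsupp.single j e l
    have h1 := LinearMap.congr_fun hg f
    simp only [LinearMap.sum_apply, LinearMap.smul_apply, LinearMap.zero_apply,
      hsingle j e f hf, smul_smul] at h1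
    rw [← h1, ← Finset.sum_smul]
    simp
  exact hli.cardinal_le_rank

end InfiniteRank

/-! ### Modules with torsion bidual -/

section BoundedTorsion

variable {R : Type u} [CommRing R] {M : Type v} [AddCommGroup M] [Module R M] {p : R}

theorem exists_pow_smul_eq_zero_of_fg {N : Submodule R M} (hN : N.FG)
    (h : ∀ x ∈ N, ∃ n : ℕ, p ^ n • x = 0) : ∃ n : ℕ, ∀ x ∈ N, p ^ n • x = 0 := by
  induction N, hN using Submodule.fg_induction with
  | singleton x =>
    obtain ⟨n, hn⟩ := h x (Submodule.mem_span_singleton_self x)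
    refine ⟨n, fun y hy => ?_⟩
    obtain ⟨r, rfl⟩ := Submodule.mem_span_singleton.1 hy
    rw [smul_comm, hn, smul_zero]
  | sup N₁ N₂ _ _ h₁ h₂ =>
    obtain ⟨m, hm⟩ := h₁ fun x hx => h x (Submodule.mem_sup_left hx)
    obtain ⟨n, hn⟩ := h₂ fun x hx => h x (Submodule.mem_sup_right hx)
    refine ⟨m + n, fun x hx => ?_⟩
    obtain ⟨y, hy, z, hz, rfl⟩ := Submodule.mem_sup.1 hx
    rw [smul_add, pow_add, mul_smul _ _ z, hn z hz, smul_zero, add_zero, mul_comm, mul_smul, hm y hy,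
      smul_zero]

end BoundedTorsion

section TorsionBidual

variable {R : Type u} [CommRing R] [IsDomain R] [IsDiscreteValuationRing R]
  {E : Type u} [AddCommGroup E] [Module R E]
  {i : IsLocalRing.ResidueField R →ₗ[R] E} {M : Type v} [AddCommGroup M] [Module R M] {p : R}

theorem exists_pow_smul_mem_fg (hE : IsInjectiveHull i) (hp : Irreducible p)
    (h : ∀ f : M →ₗ[R] E, ∃ r : R, r ≠ 0 ∧ r • f = 0) :
    ∃ (j : ℕ) (N : Submodule R M), N.FG ∧ ∀ y, p ^ j • y ∈ N := by
  by_contra! hcon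
  obtain ⟨f, hf⟩ := exists_forall_pow_smul_ne_zero hE p hcon
  obtain ⟨r, hr, h0⟩ := h f
  obtain ⟨n, hn⟩ := exists_pow_smul_eq_zero hp hr h0
  exact hf n hn

/-- If `p ^ j • M` lies in a finitely generated submodule, then enlarging `j` makes `p ^ j • M`
torsion-free, since the torsion of a finitely generated module is bounded. -/
theorem exists_pow_smul_mem_torsionFree (hp : Irreducible p) {j : ℕ} {N : Submodule R M}
    (hN : N.FG) (h : ∀ y : M, p ^ j • y ∈ N) :
    ∃ l : ℕ, (∀ y : M, p ^ l • y ∈ N) ∧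
      ∀ (y : M) (r : R), r ≠ 0 → r • p ^ l • y = 0 → p ^ l • y = 0 := by
  have : IsNoetherian R N := isNoetherian_of_fg_of_noetherian N hN
  have hT : (Submodule.torsion R M ⊓ N).FG := Submodule.FG.of_le hN inf_le_right
  obtain ⟨m, hm⟩ := exists_pow_smul_eq_zero_of_fg (p := p) hT (by
    rintro x ⟨hx, -⟩
    obtain ⟨a, ha⟩ := (Submodule.mem_torsion_iff x).1 hx
    exact exists_pow_smul_eq_zero hp (nonZeroDivisors.ne_zero a.2) ha)
  refine ⟨m + j, fun y => ?_, fun y r hr h0 => ?_⟩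
  · rw [pow_add, mul_smul]
    exact N.smul_mem _ (h y)
  · rw [pow_add, mul_smul]
    refine hm _ ⟨(Submodule.mem_torsion_iff _).2
      ⟨⟨r * p ^ m, mem_nonZeroDivisors_of_ne_zero
        (mul_ne_zero hr (pow_ne_zero m hp.ne_zero))⟩, ?_⟩, h y⟩
    rw [pow_add, mul_smul] at h0
    rw [← h0, ← mul_smul]
    rfl

/-- The main consequence of a torsion bidual: some `p ^ j • M` is divisible, and its dual is
finitely generated. If `p ^ j • M°` is torsion-free, a functional vanishing on `p ^ (j + 1) • M`
vanishes on `p ^ j • M`, whence the divisibility. -/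
theorem exists_pow_smul_divisible (hE : IsInjectiveHull i) (hp : Irreducible p)
    (h : ∀ φ : MatlisDual R E (MatlisDual R E M), ∃ r : R, r ≠ 0 ∧ r • φ = 0) :
    ∃ (j : ℕ) (N : Submodule R (MatlisDual R E M)), N.FG ∧ (∀ f : M →ₗ[R] E, p ^ j • f ∈ N) ∧
      ∀ x : M, ∃ y : M, p ^ j • x = p ^ (j + 1) • y := by
  obtain ⟨j₀, N, hN, hj₀⟩ := exists_pow_smul_mem_fg hE hp h
  obtain ⟨j, hj, htf⟩ := exists_pow_smul_mem_torsionFree hp hN hj₀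
  refine ⟨j, N, hN, hj, fun x => ?_⟩
  by_contra! hx
  obtain ⟨f, hf, hfx⟩ := exists_dual_ne_zero_of_notMem hE
    (LinearMap.range (LinearMap.lsmul R M (p ^ (j + 1)))) (x := p ^ j • x) (by
      rintro ⟨y, hy⟩
      exact hx y hy.symm)
  have h0 : p ^ j • f = 0 := htf f p hp.ne_zero (LinearMap.ext fun y => by
    have := hf _ ⟨y, rfl⟩
    rw [LinearMap.lsmul_apply, map_smul, pow_succ', mul_smul] at this
    exact this)
  exact hfx (by rw [map_smul]; exact LinearMap.congr_fun h0 x)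

theorem finite_dual_range_lsmul (hE : IsInjectiveHull i) {a : R}
    {N : Submodule R (MatlisDual R E M)} (hN : N.FG) (h : ∀ f : M →ₗ[R] E, a • f ∈ N) :
    Module.Finite R (MatlisDual R E (LinearMap.range (LinearMap.lsmul R M a))) := by
  have : IsNoetherian R N := isNoetherian_of_fg_of_noetherian N hN
  let L := LinearMap.lcomp R E (LinearMap.lsmul R M a).rangeRestrict
  have hL : ∀ g, L g ∈ N := by
    intro g
    obtain ⟨f, hf⟩ := exists_comp_eq_of_ker_le (baer_of_isInjectiveHull hE)
      (Submodule.subtype _) g (fun x hx => by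
        have : x = 0 := by simpa using hx
        rw [this, map_zero])
    have : L g = a • f := LinearMap.ext fun x => by
      rw [LinearMap.smul_apply, ← map_smul]
      exact (hf _).symm
    rw [this]
    exact h f
  refine Module.Finite.of_injective (L.codRestrict N hL) ?_
  rw [LinearMap.injective_codRestrict_iff]
  intro g₁ g₂ hg
  ext ⟨_, x, rfl⟩
  exact LinearMap.congr_fun hg x

theorem baer_of_divisible {D : Type*} [AddCommGroup D] [Module R D] (hp : Irreducible p)
    (h : ∀ x : D, ∃ y, p • y = x) : Module.Baer R D := by
  have hpow : ∀ (n : ℕ) (x : D), ∃ y, p ^ n • y = x := by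
    intro n
    induction n with
    | zero => exact fun x => ⟨x, by simp⟩
    | succ n ih =>
      intro x
      obtain ⟨y, rfl⟩ := h x
      obtain ⟨z, rfl⟩ := ih y
      exact ⟨z, by rw [pow_succ', mul_smul]⟩
  intro I f
  obtain ⟨a, rfl⟩ := (IsPrincipalIdealRing.principal I).principal
  by_cases ha : a = 0
  · subst ha
    refine ⟨0, fun x hx => ?_⟩
    have hx0 : (⟨x, hx⟩ : Submodule.span R {(0 : R)}) = 0 := Subtype.ext (by simpa using hx)
    rw [hx0, map_zero, LinearMap.zero_apply]
  · obtain ⟨n, c, hc⟩ := IsDiscreteValuationRing.eq_unit_mul_pow_irreducible ha hp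
    obtain ⟨y, hy⟩ := hpow n ((↑c⁻¹ : R) • f ⟨a, Submodule.mem_span_singleton_self a⟩)
    have hay : a • y = f ⟨a, Submodule.mem_span_singleton_self a⟩ :=
      calc a • y = (↑c * p ^ n) • y := by rw [← hc]
        _ = _ := by rw [mul_smul, hy, smul_smul, Units.mul_inv, one_smul]
    refine ⟨LinearMap.toSpanSingleton R D y, fun x hx => ?_⟩
    obtain ⟨b, rfl⟩ := Submodule.mem_span_singleton.1 hx
    have e : (⟨b • a, hx⟩ : Submodule.span R {a})
        = b • ⟨a, Submodule.mem_span_singleton_self a⟩ := rfl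
    rw [e, map_smul f, LinearMap.toSpanSingleton_apply, smul_assoc, hay]

end TorsionBidual

/-! ### Criteria for completeness -/

section EndIsScalar

variable {R : Type u} [CommRing R] [IsDomain R] [IsDiscreteValuationRing R]
  {E : Type u} [AddCommGroup E] [Module R E]
  {i : IsLocalRing.ResidueField R →ₗ[R] E} {M : Type v} [AddCommGroup M] [Module R M] {p : R}

/-- If `M°° / M` is torsion and `x : M` is not a torsion element, then `R` is complete: for an
endomorphism `φ` of `E`, the functional `f ↦ φ (f x)` has a nonzero multiple that is the
evaluation at an element `y`, necessarily a multiple of `x`. -/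
theorem endIsScalar_of_not_torsion (hE : IsInjectiveHull i)
    (h : ∀ φ : MatlisDual R E (MatlisDual R E M), ∃ r : R, r ≠ 0 ∧ ∃ x, r • φ = matlisEval R E M x)
    {x : M} (hx : ∀ r : R, r • x = 0 → r = 0) : EndIsScalar R E := by
  intro φ
  obtain ⟨r, hr, y, hy⟩ := h (φ ∘ₗ LinearMap.applyₗ x)
  have hy' : ∀ f : M →ₗ[R] E, r • φ (f x) = f y := fun f => LinearMap.congr_fun hy f
  obtain ⟨s, rfl⟩ : ∃ s : R, s • x = y := by
    rw [← Submodule.mem_span_singleton]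
    by_contra hn
    obtain ⟨f, hf, hfy⟩ := exists_dual_ne_zero_of_notMem hE _ hn
    refine hfy ?_
    rw [← hy', hf x (Submodule.mem_span_singleton_self x), map_zero, smul_zero]
  have hφ : ∀ e : E, r • φ e = s • e := by
    intro e
    obtain ⟨f, hf⟩ := exists_comp_eq_of_ker_le (baer_of_isInjectiveHull hE)
      (LinearMap.toSpanSingleton R M x) (LinearMap.toSpanSingleton R E e)
      (fun a ha => by rw [hx a ha, map_zero])
    have hfx : f x = e := by simpa using hf 1
    have := hy' f
    rwa [map_smul, hfx] at this
  obtain ⟨t, rfl⟩ : r ∣ s := dvd_of_forall_smul_eq_zero hE fun e he => by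
    rw [← hφ, ← map_smul, he, map_zero]
  refine ⟨t, fun e => ?_⟩
  obtain ⟨e', rfl⟩ := exists_smul_eq hE hr e
  rw [map_smul, hφ, smul_smul, mul_comm]

/-- `End_R E` is generated by the identity modulo `p`, so if it is finitely generated, then
Nakayama's lemma shows that it consists of scalars. -/
theorem endIsScalar_of_finite (hE : IsInjectiveHull i) (hp : Irreducible p)
    (hfin : Module.Finite R (E →ₗ[R] E)) : EndIsScalar R E := by
  have hle : (⊤ : Submodule R (E →ₗ[R] E)) ≤ Submodule.span R {LinearMap.id} := by
    refine Submodule.le_of_le_smul_of_le_jacobson_bot (I := IsLocalRing.maximalIdeal R) hfin.1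
      (IsLocalRing.maximalIdeal_le_jacobson _) ?_
    rintro φ -
    obtain ⟨s, hs⟩ := hull_socle hE hp (e := φ (i 1)) (by
      rw [← map_smul, (smul_apply_one_eq_zero_iff hE p).2 (by
        rw [hp.maximalIdeal_eq]; exact Ideal.mem_span_singleton_self p), map_zero])
    -- `φ - s` kills the `p`-torsion of `E`, so it factors through multiplication by `p`
    obtain ⟨ψ, hψ⟩ := exists_comp_eq_of_ker_le (baer_of_isInjectiveHull hE)
      (LinearMap.lsmul R E p) (φ - s • LinearMap.id) (by
        intro e he
        obtain ⟨t, rfl⟩ := hull_socle hE hp he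
        rw [map_smul, LinearMap.sub_apply, hs, LinearMap.smul_apply, LinearMap.id_apply, sub_self,
          smul_zero])
    have hφ : φ = s • LinearMap.id + p • ψ := by
      ext e
      have := hψ e
      rw [LinearMap.lsmul_apply, map_smul, LinearMap.sub_apply] at this
      rw [LinearMap.add_apply, LinearMap.smul_apply p, this, add_sub_cancel]
    rw [hφ]
    refine Submodule.add_mem_sup
      (Submodule.smul_mem _ _ (Submodule.mem_span_singleton_self _))
      (Submodule.smul_mem_smul ?_ Submodule.mem_top)
    rw [hp.maximalIdeal_eq]
    exact Ideal.mem_span_singleton_self p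
  intro φ
  obtain ⟨t, rfl⟩ := Submodule.mem_span_singleton.1 (hle (Submodule.mem_top (x := φ)))
  exact ⟨t, fun e => rfl⟩

/-- If `p ^ j • M` is divisible and contains a nonzero torsion element, then `E` is a direct summand
of `M`, and finite generation of `p ^ j • M°` passes to `p ^ j • E° ≃ E°`. -/
theorem endIsScalar_of_divisible (hE : IsInjectiveHull i) (hp : Irreducible p) {j : ℕ}
    {N : Submodule R (MatlisDual R E M)} (hN : N.FG) (hj : ∀ f : M →ₗ[R] E, p ^ j • f ∈ N)
    (hdiv : ∀ x : M, ∃ y : M, p ^ j • x = p ^ (j + 1) • y) {x : M} (hx0 : p ^ j • x ≠ 0)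
    {r : R} (hr : r ≠ 0) (hrx : r • p ^ j • x = 0) : EndIsScalar R E := by
  classical
  let S := LinearMap.range (LinearMap.lsmul R M (p ^ j))
  have hS : Module.Baer R S := baer_of_divisible hp (by
    rintro ⟨_, y, rfl⟩
    obtain ⟨z, hz⟩ := hdiv y
    refine ⟨⟨p ^ j • z, z, rfl⟩, Subtype.ext ?_⟩
    change p • p ^ j • z = p ^ j • y
    rw [hz, pow_succ', mul_smul])
  -- a nonzero element of `S` killed by `p`
  obtain ⟨z, hz0, hpz⟩ : ∃ z : S, z ≠ 0 ∧ p • z = 0 := by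
    have hex := exists_pow_smul_eq_zero hp hr hrx
    have hpos : Nat.find hex ≠ 0 := fun h => hx0 (by simpa [h] using Nat.find_spec hex)
    obtain ⟨n, hn⟩ := Nat.exists_eq_succ_of_ne_zero hpos
    refine ⟨p ^ n • ⟨p ^ j • x, x, rfl⟩, fun h => ?_, ?_⟩
    · exact Nat.find_min hex (m := n) (by omega) (congrArg Subtype.val h)
    · rw [smul_smul, ← pow_succ', ← Nat.succ_eq_add_one, ← hn]
      exact Subtype.ext (Nat.find_spec hex)
  obtain ⟨g, hg⟩ := exists_comp_eq_of_ker_le hS (LinearMap.toSpanSingleton R E (i 1))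
    (LinearMap.toSpanSingleton R S z) (by
      intro a ha
      have : a ∈ IsLocalRing.maximalIdeal R := (smul_apply_one_eq_zero_iff hE a).1 ha
      rw [hp.maximalIdeal_eq, Ideal.mem_span_singleton] at this
      obtain ⟨b, rfl⟩ := this
      rw [LinearMap.toSpanSingleton_apply, mul_comm, mul_smul, hpz, smul_zero])
  have hginj : LinearMap.ker g = ⊥ := by
    refine hE.essential _ (eq_bot_iff.2 ?_)
    rintro _ ⟨hc, c, rfl⟩
    obtain ⟨s, rfl⟩ := IsLocalRing.residue_surjective c
    have hs : i (IsLocalRing.residue R s) = s • i 1 := by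
      rw [← map_smul, Algebra.smul_def, mul_one]; rfl
    have h1 : s • z = 0 := (hg s).symm.trans (by
      rw [LinearMap.toSpanSingleton_apply, ← hs]; exact hc)
    have hsm : ¬ IsUnit s := fun hu => hz0 ((IsUnit.smul_eq_zero hu).1 h1)
    rw [hs]
    exact (Submodule.mem_bot R).2 ((smul_apply_one_eq_zero_iff hE s).2 hsm)
  obtain ⟨ρ, hρ⟩ := exists_comp_eq_of_ker_le (baer_of_isInjectiveHull hE) (S.subtype ∘ₗ g)
    LinearMap.id (fun e he => by
      have : e ∈ LinearMap.ker g := Subtype.ext he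
      rw [hginj] at this
      exact (Submodule.mem_bot R).1 this)
  let N' := N.map (LinearMap.lcomp R E (S.subtype ∘ₗ g))
  have hN' : N'.FG := hN.map _
  have : IsNoetherian R N' := isNoetherian_of_fg_of_noetherian N' hN'
  have hmem : ∀ φ : E →ₗ[R] E, LinearMap.lsmul R (E →ₗ[R] E) (p ^ j) φ ∈ N' := fun φ =>
    ⟨p ^ j • φ ∘ₗ ρ, hj _, LinearMap.ext fun e => by
      change p ^ j • φ (ρ ((S.subtype ∘ₗ g) e)) = p ^ j • φ e
      rw [hρ e]; rfl⟩
  refine endIsScalar_of_finite hE hp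
    (Module.Finite.of_injective ((LinearMap.lsmul R _ (p ^ j)).codRestrict N' hmem) ?_)
  rw [LinearMap.injective_codRestrict_iff, injective_iff_map_eq_zero]
  intro φ hφ
  ext e
  obtain ⟨e', rfl⟩ := exists_smul_eq hE (pow_ne_zero j hp.ne_zero) e
  rw [map_smul]
  exact LinearMap.congr_fun hφ e'

end EndIsScalar

/-! ### The divisible part -/

section DivisiblePart

variable {R : Type u} [CommRing R] {M : Type v} [AddCommGroup M] [Module R M]

/-- The largest `p`-divisible submodule of `M`: the elements that start a sequence in which every
term is `p` times the next one. -/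
def divisiblePart (p : R) (M : Type v) [AddCommGroup M] [Module R M] : Submodule R M where
  carrier := {x | ∃ s : ℕ → M, s 0 = x ∧ ∀ n, p • s (n + 1) = s n}
  zero_mem' := ⟨0, rfl, fun _ => smul_zero _⟩
  add_mem' := by
    rintro _ _ ⟨s, rfl, hs⟩ ⟨t, rfl, ht⟩
    exact ⟨s + t, rfl, fun n => by simp [hs, ht]⟩
  smul_mem' := by
    rintro r _ ⟨s, rfl, hs⟩
    exact ⟨r • s, rfl, fun n => by simp [smul_comm p r, hs]⟩

theorem exists_pow_smul_eq_of_mem_divisiblePart {p : R} {x : M} (hx : x ∈ divisiblePart p M)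
    (n : ℕ) : ∃ y ∈ divisiblePart p M, p ^ n • y = x := by
  obtain ⟨s, rfl, hs⟩ := hx
  refine ⟨s n, ⟨fun k => s (n + k), rfl, fun k => hs (n + k)⟩, ?_⟩
  induction n with
  | zero => simp
  | succ n ih => rw [pow_succ, mul_smul, hs, ih]

end DivisiblePart

/-! ### Decomposition -/

section Decomposition

variable {R : Type u} [CommRing R] [IsDomain R] [IsDiscreteValuationRing R]
  {E : Type u} [AddCommGroup E] [Module R E]
  {i : IsLocalRing.ResidueField R →ₗ[R] E} {M : Type v} [AddCommGroup M] [Module R M] {p : R}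

/-- Over a complete ring, divisibility modulo a finitely generated submodule `F` lifts: a sequence
`X` with `p • X (n + 1) = X n + f n` and `f n ∈ F` is corrected by a convergent series in `F` to a
sequence with `p • X (n + 1) = X n`. -/
theorem EndIsScalar.pow_smul_mem_divisiblePart_sup (hc : EndIsScalar R E) (hE : IsInjectiveHull i)
    (hp : Irreducible p) {F : Submodule R M} (hF : F.FG) {j : ℕ}
    (hdiv : ∀ x : M, ∃ y : M, p ^ j • x - p ^ (j + 1) • y ∈ F) (x : M) :
    p ^ j • x ∈ divisiblePart p M ⊔ F := by
  choose next hnext using hdiv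
  let X : ℕ → M := fun n => p ^ j • next^[n] x
  have hX : ∀ n, p • X (n + 1) - X n ∈ F := fun n => by
    have h := F.neg_mem (hnext (next^[n] x))
    rwa [neg_sub, pow_succ', mul_smul, ← Function.iterate_succ_apply' next n x] at h
  obtain ⟨g, hgF, hg⟩ := hc.exists_series_of_fg hE hp hF _ hX
  have hD : X 0 + g 0 ∈ divisiblePart p M := ⟨fun n => X n + g n, rfl, fun n => by
    change p • (X (n + 1) + g (n + 1)) = X n + g n
    rw [hg n, smul_add]
    abel⟩
  have h0 : p ^ j • x = (X 0 + g 0) + -g 0 := by rw [add_neg_cancel_right]; rfl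
  rw [h0]
  exact Submodule.add_mem_sup hD (F.neg_mem (hgF 0))

/-- A module with a finitely generated, torsion-free multiple `a • M` modulo a submodule `D`
decomposes as `L ⊕ W`, where `L` is finitely generated and `W` consists of the elements that `a`
sends into `D`. -/
theorem exists_isCompl_fg_comap (D : Submodule R M) {a : R} {N : Submodule R (M ⧸ D)} (hN : N.FG)
    (ha : ∀ v : M ⧸ D, a • v ∈ N)
    (htf : ∀ (v : M ⧸ D) (r : R), r ≠ 0 → r • a • v = 0 → a • v = 0) :
    ∃ L : Submodule R M, L.FG ∧ IsCompl L (D.comap (LinearMap.lsmul R M a)) := by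
  have : IsNoetherian R N := isNoetherian_of_fg_of_noetherian N hN
  let V := LinearMap.range (LinearMap.lsmul R (M ⧸ D) a)
  have hVN : V ≤ N := by
    rintro _ ⟨v, rfl⟩
    exact ha v
  have hfin : Module.Finite R V := Module.Finite.of_fg (Submodule.FG.of_le hN hVN)
  have htf' : Module.IsTorsionFree R V := Module.IsTorsionFree.of_smul_eq_zero (by
    rintro r ⟨_, v, rfl⟩ h
    by_cases hr : r = 0
    · exact Or.inl hr
    · exact Or.inr (Subtype.ext (htf v r hr (congrArg Subtype.val h))))
  -- `V` is projective, so the surjection `x ↦ a • [x]` from `M` to `V` splits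
  let π : M →ₗ[R] V := (LinearMap.lsmul R (M ⧸ D) a).rangeRestrict ∘ₗ D.mkQ
  have hπ : Function.Surjective π :=
    (LinearMap.surjective_rangeRestrict _).comp D.mkQ_surjective
  obtain ⟨σ, hσ⟩ := Module.projective_lifting_property π LinearMap.id hπ
  have hσ' : ∀ v, π (σ v) = v := LinearMap.congr_fun hσ
  have hker : ∀ x, x ∈ D.comap (LinearMap.lsmul R M a) ↔ π x = 0 := fun x => by
    rw [Submodule.mem_comap, ← Submodule.Quotient.mk_eq_zero, ← Subtype.coe_inj]
    rfl
  refine ⟨LinearMap.range σ, ?_, ?_, ?_⟩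
  · rw [LinearMap.range_eq_map]
    exact hfin.1.map σ
  · rw [Submodule.disjoint_def]
    rintro _ ⟨v, rfl⟩ hv
    rw [hker, hσ'] at hv
    rw [hv, map_zero]
  · rw [codisjoint_iff, eq_top_iff]
    intro x _
    rw [← add_sub_cancel (σ (π x)) x]
    refine Submodule.add_mem_sup ⟨_, rfl⟩ ((hker _).2 ?_)
    rw [map_sub, hσ', sub_self]

/-- The decomposition over a complete ring, for a module `M` with a finitely generated submodule `F`
such that `(M / F)°°` is torsion. The reflexive summand is the sum of the largest divisible
submodule and a finitely generated one. It is reflexive because the divisible submodule lies in the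
preimage `P` of `p ^ j • (M / F)`, an extension of a module with finitely generated dual by `F`. -/
theorem EndIsScalar.exists_isCompl (hc : EndIsScalar R E) (hE : IsInjectiveHull i)
    (hp : Irreducible p) {F : Submodule R M} (hF : F.FG)
    (hT : ∀ φ : MatlisDual R E (MatlisDual R E (M ⧸ F)), ∃ r : R, r ≠ 0 ∧ r • φ = 0) :
    ∃ M₁ M₂ : Submodule R M, IsCompl M₁ M₂ ∧
      IsMatlisReflexive R E M₁ ∧ IsBoundedModule R M₂ := by
  obtain ⟨j, N, hN, hj, hdiv⟩ := exists_pow_smul_divisible hE hp hT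
  let D := divisiblePart p M
  have hsup : ∀ x : M, p ^ j • x ∈ D ⊔ F := by
    refine hc.pow_smul_mem_divisiblePart_sup hE hp hF fun x => ?_
    obtain ⟨y, hy⟩ := hdiv (F.mkQ x)
    obtain ⟨y, rfl⟩ := F.mkQ_surjective y
    refine ⟨y, ?_⟩
    rwa [← Submodule.Quotient.mk_eq_zero, Submodule.Quotient.mk_sub, sub_eq_zero]
  obtain ⟨l, hl, htf⟩ := exists_pow_smul_mem_torsionFree hp (hF.map D.mkQ) (j := j) (by
    intro v
    obtain ⟨x, rfl⟩ := D.mkQ_surjective v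
    obtain ⟨d, hd, f, hf, hdf⟩ := Submodule.mem_sup.1 (hsup x)
    refine ⟨f, hf, ?_⟩
    rw [← map_smul, ← hdf, map_add, show D.mkQ d = 0 from (Submodule.Quotient.mk_eq_zero D).2 hd,
      zero_add])
  obtain ⟨L, hL, hLW⟩ := exists_isCompl_fg_comap D (hF.map D.mkQ) hl htf
  have hDW : D ≤ D.comap (LinearMap.lsmul R M (p ^ l)) := fun x hx => D.smul_mem _ hx
  -- the divisible part is injective, hence a direct summand
  obtain ⟨ρ, hρ⟩ := exists_comp_eq_of_ker_le (baer_of_divisible (D := D) hp (by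
      rintro ⟨x, hx⟩
      obtain ⟨y, hy, hyx⟩ := exists_pow_smul_eq_of_mem_divisiblePart hx 1
      exact ⟨⟨y, hy⟩, Subtype.ext (by rw [pow_one] at hyx; exact hyx)⟩))
    D.subtype LinearMap.id (fun x hx => Subtype.ext hx)
  have hDC : IsCompl D (LinearMap.ker ρ) := LinearMap.isCompl_of_proj hρ
  have hW : D ⊔ LinearMap.ker ρ ⊓ D.comap (LinearMap.lsmul R M (p ^ l))
      = D.comap (LinearMap.lsmul R M (p ^ l)) := by
    rw [← sup_inf_assoc_of_le _ hDW, hDC.sup_eq_top, top_inf_eq]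
  have hcompl : IsCompl (L ⊔ D) (LinearMap.ker ρ ⊓ D.comap (LinearMap.lsmul R M (p ^ l))) :=
    Disjoint.isCompl_sup_left_of_isCompl_sup_right (hDC.disjoint.mono_right inf_le_left)
      (by rwa [hW])
  refine ⟨_, _, hcompl, ?_, p ^ l, pow_ne_zero l hp.ne_zero, ?_⟩
  · rw [isMatlisReflexive_iff_surjective hE]
    let S := LinearMap.range (LinearMap.lsmul R (M ⧸ F) (p ^ j))
    let P := S.comap F.mkQ
    have hDP : D ≤ P := fun x hx => by
      obtain ⟨y, -, rfl⟩ := exists_pow_smul_eq_of_mem_divisiblePart hx j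
      exact ⟨F.mkQ y, (map_smul F.mkQ _ _).symm⟩
    have hP : Function.Surjective (matlisEval R E P) := by
      refine surjective_matlisEval_of_extension hE (F.mkQ.restrict (p := P) (q := S) fun x hx => hx)
        ?_ (hc.surjective_matlisEval_of_fg hE ?_)
        (hc.surjective_matlisEval_of_finite_dual hE (finite_dual_range_lsmul hE hN hj))
      · rintro ⟨v, hv⟩
        obtain ⟨x, rfl⟩ := F.mkQ_surjective v
        exact ⟨⟨x, hv⟩, rfl⟩
      · refine Submodule.fg_of_fg_map_injective P.subtype P.injective_subtype
          (Submodule.FG.of_le hF ?_)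
        rintro _ ⟨x, hx, rfl⟩
        exact (Submodule.Quotient.mk_eq_zero F).1 (congrArg Subtype.val hx)
    let pr := (L ⊔ D).projectionOnto _ hcompl
    refine surjective_matlisEval_of_surjective hE ((pr ∘ₗ L.subtype).coprod (pr ∘ₗ P.subtype)) ?_
      (surjective_matlisEval_prod (hc.surjective_matlisEval_of_fg hE hL) hP)
    rintro ⟨y, hy⟩
    obtain ⟨a, ha, b, hb, rfl⟩ := Submodule.mem_sup.1 hy
    refine ⟨(⟨a, ha⟩, ⟨b, hDP hb⟩), ?_⟩
    rw [LinearMap.coprod_apply]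
    change pr a + pr b = _
    rw [← map_add]
    exact Submodule.projectionOnto_apply_of_mem_left hcompl hy
  · rintro ⟨x, hxC, hxW⟩
    refine Subtype.ext ?_
    exact (Submodule.disjoint_def.1 hDC.disjoint) _ hxW (Submodule.smul_mem _ _ hxC)

/-- The decomposition for a module of finite rank with `M°° / M` torsion. Unless `M` is bounded, the
hypothesis forces `R` to be complete. -/
theorem exists_isCompl_of_torsion_coker (hE : IsInjectiveHull i)
    (hfin : Module.rank R M < Cardinal.aleph0)
    (h : ∀ φ : MatlisDual R E (MatlisDual R E M),
      ∃ r : R, r ≠ 0 ∧ ∃ x, r • φ = matlisEval R E M x) :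
    ∃ M₁ M₂ : Submodule R M, IsCompl M₁ M₂ ∧
      IsMatlisReflexive R E M₁ ∧ IsBoundedModule R M₂ := by
  obtain ⟨p, hp⟩ := IsDiscreteValuationRing.exists_irreducible R
  by_cases hc : EndIsScalar R E
  · obtain ⟨F, hF, hMF⟩ := exists_fg_isTorsion_quotient hfin
    refine hc.exists_isCompl hE hp hF fun φ => ?_
    obtain ⟨ψ, hψ⟩ := exists_comp_eq_of_ker_le (baer_of_isInjectiveHull hE)
      (LinearMap.lcomp R E F.mkQ) φ (by
        intro f hf
        have : f = 0 := by
          ext x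
          exact LinearMap.congr_fun hf x
        rw [this, map_zero])
    obtain ⟨r, hr, x, hx⟩ := h ψ
    obtain ⟨s, hs, hsx⟩ := hMF x
    refine ⟨s * r, mul_ne_zero hs hr, LinearMap.ext fun f => ?_⟩
    have h1 : r • ψ (f ∘ₗ F.mkQ) = f (F.mkQ x) := LinearMap.congr_fun hx (f ∘ₗ F.mkQ)
    have h2 : ψ (f ∘ₗ F.mkQ) = φ f := hψ f
    rw [LinearMap.smul_apply, mul_smul, ← h2, h1, ← map_smul, ← map_smul,
      show F.mkQ (s • x) = 0 from (Submodule.Quotient.mk_eq_zero F).2 hsx, map_zero]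
    rfl
  · have htor : ∀ x : M, ∃ r : R, r ≠ 0 ∧ r • x = 0 := by
      intro x
      by_contra! hx
      exact hc (endIsScalar_of_not_torsion hE h (x := x) fun r hr => by
        by_contra h0
        exact hx r h0 hr)
    obtain ⟨j, N, hN, hj, hdiv⟩ := exists_pow_smul_divisible hE hp (M := M) fun φ => by
      obtain ⟨r, hr, x, hx⟩ := h φ
      obtain ⟨s, hs, hsx⟩ := htor x
      exact ⟨s * r, mul_ne_zero hs hr, by rw [mul_smul, hx, ← map_smul, hsx, map_zero]⟩
    refine ⟨⊥, ⊤, isCompl_bot_top, ?_, p ^ j, pow_ne_zero j hp.ne_zero, ?_⟩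
    · rw [isMatlisReflexive_iff_surjective hE]
      intro φ
      refine ⟨0, LinearMap.ext fun f => ?_⟩
      rw [Subsingleton.elim f 0, map_zero, map_zero]
    · rintro ⟨x, -⟩
      refine Subtype.ext ?_
      by_contra hx
      obtain ⟨r, hr, hrx⟩ := htor (p ^ j • x)
      exact hc (endIsScalar_of_divisible hE hp hN hj hdiv hx hr hrx)

end Decomposition

/-! ### The converse -/

section Converse

variable {R : Type u} [CommRing R] {E : Type u} [AddCommGroup E] [Module R E]
  {M : Type v} [AddCommGroup M] [Module R M]

theorem exists_smul_eq_matlisEval_of_isCompl {M₁ M₂ : Submodule R M} (hM : IsCompl M₁ M₂)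
    (h₁ : Function.Surjective (matlisEval R E M₁)) {r : R} (hr : ∀ x : M₂, r • x = 0)
    (φ : MatlisDual R E (MatlisDual R E M)) : ∃ x, r • φ = matlisEval R E M x := by
  obtain ⟨a, ha⟩ := h₁ (φ ∘ₗ LinearMap.lcomp R E (M₁.projectionOnto M₂ hM))
  refine ⟨r • a, LinearMap.ext fun f => ?_⟩
  have h1 : f a = φ ((f ∘ₗ M₁.subtype) ∘ₗ M₁.projectionOnto M₂ hM) :=
    LinearMap.congr_fun ha (f ∘ₗ M₁.subtype)
  change r • φ f = f (r • a)
  rw [map_smul, h1, ← map_smul, ← map_smul]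
  -- `r • f` vanishes on `M₂`, so it only depends on the component in `M₁`
  congr 1
  refine LinearMap.ext fun x => ?_
  obtain ⟨y, hy, z, hz, rfl⟩ := Submodule.mem_sup.1
    (hM.sup_eq_top ▸ Submodule.mem_top : x ∈ M₁ ⊔ M₂)
  have hz0 : r • z = 0 := congrArg Subtype.val (hr ⟨z, hz⟩)
  have hpr : M₁.projectionOnto M₂ hM (y + z) = ⟨y, hy⟩ := by
    rw [map_add, Submodule.projectionOnto_apply_of_mem_left hM hy,
      (Submodule.projectionOnto_apply_eq_zero_iff hM).2 hz, add_zero]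
  change r • f (y + z) = r • f (M₁.projectionOnto M₂ hM (y + z))
  rw [hpr, ← map_smul f r (y + z), smul_add, hz0, add_zero, map_smul]

end Converse

end MatlisDuality

open MatlisDuality in
theorem mainTheorem7 (R : Type u) [CommRing R] [IsDomain R] [IsDiscreteValuationRing R]
    (E : Type u) [AddCommGroup E] [Module R E]
    (i : IsLocalRing.ResidueField R →ₗ[R] E) (hE : IsInjectiveHull i)
    (M : Type v) [AddCommGroup M] [Module R M] :
    moduleRank R M = moduleRank R (MatlisDual R E (MatlisDual R E M)) ↔
      ∃ M₁ M₂ : Submodule R M, IsCompl M₁ M₂ ∧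
        IsMatlisReflexive R E M₁ ∧ IsBoundedModule R M₂ := by
  have hinj : Function.Injective (matlisEval R E M) := matlisEval_injective hE
  have hadd := rank_quotient_range_add_lift_rank hinj
  have hzero := rank_quotient_eq_zero_iff (LinearMap.range (matlisEval R E M))
  rw [moduleRank_eq_lift_rank, moduleRank_eq_lift_rank, Cardinal.lift_id'.{u, max u v}]
  constructor
  · intro heq
    have hfin : Module.rank R M < Cardinal.aleph0 := by
      by_contra hinf
      obtain ⟨s, hs, hli⟩ := exists_set_linearIndependent_of_isDomain R M
      have : Infinite s := by
        rw [← Cardinal.aleph0_le_mk_iff, hs]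
        exact not_lt.1 hinf
      have h1 := lift_rank_lt_rank_pi (R := R) (ι := s)
      rw [hs, heq] at h1
      exact h1.not_ge (rank_pi_le_rank_bidual hE hli)
    have h0 : Module.rank R (MatlisDual R E (MatlisDual R E M) ⧸
        LinearMap.range (matlisEval R E M)) = 0 := by
      refine Cardinal.eq_of_add_eq_add_right
        (b := Cardinal.lift.{u} (Module.rank R M)) ?_ (Cardinal.lift_lt_aleph0.2 hfin)
      rw [hadd, zero_add, heq]
    refine exists_isCompl_of_torsion_coker hE hfin fun φ => ?_
    obtain ⟨r, hr, x, hx⟩ := hzero.1 h0 φ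
    exact ⟨r, hr, x, hx.symm⟩
  · rintro ⟨M₁, M₂, hM, h₁, r, hr, hr₂⟩
    rw [← hadd, hzero.2 fun φ => ?_, zero_add]
    obtain ⟨x, hx⟩ := exists_smul_eq_matlisEval_of_isCompl hM h₁.2 hr₂ φ
    exact ⟨r, hr, x, hx.symm⟩
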